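/- For a finite group $G$ let $M(G)=H_2(G,\mathbb Z)$ denote its Schur multiplier. Let $G,H$ be finite groups and let $U\le G\times H$ be a subdirect product, i.e. a subgroup whose projections to $G$ and to $H$ are both surjective. Put $k_1(U)=\{g\in G : (g,1)\in U\}$, a normal subgroup of $G$, and let $q(U)=G/k_1(U)$ be the Goursat quotient of $U$. For a prime $p$, call $U$ *$p$-extensible* if for every abelian group $A$ such that for every integer $n\ge 1$ the $n$-torsion subgroup $\{a\in A : a^n=1\}$ is cyclic of order $n_p$ (the largest power of $p$ dividing $n$), every homomorphism $U\to A$ extends to a homomorphism $G\times H\to A$. **Theorem.** Let $p$ be a prime, $G,H$ finite groups and $U\le G\times H$ a subdirect product. Then $U$ is $p$-extensible if one of the following conditions holds: 1. the $p$-primary part of $M(q(U))$ is trivial; 2. the $p$-primary component $H_2(G,\mathbb Z)_p\to H_2(G/k_1(U),\mathbb Z)_p$ of the coinflation map $H_2(G,\mathbb Z)\to H_2(G/k_1(U),\mathbb Z)$, induced by the quotient homomorphism $G\to G/k_1(U)$, is surjective. -/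

import Mathlib

universe u v w

noncomputable section

namespace SubdirectExt

/-! ### Subgroups of direct products -/

section Goursat

variable {G : Type u} {H : Type v} [Group G] [Group H]

/-- `p₁(U) = {g ∈ G | ∃ h ∈ H, (g, h) ∈ U}`. -/
def p₁ (U : Subgroup (G × H)) : Subgroup G := U.map (MonoidHom.fst G H)

/-- `p₂(U) = {h ∈ H | ∃ g ∈ G, (g, h) ∈ U}`. -/
def p₂ (U : Subgroup (G × H)) : Subgroup H := U.map (MonoidHom.snd G H)

/-- `k₁(U) = {g ∈ G | (g, 1) ∈ U}`. -/
def k₁ (U : Subgroup (G × H)) : Subgroup G := U.comap (MonoidHom.inl G H)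

theorem mem_p₁ {U : Subgroup (G × H)} {g : G} : g ∈ p₁ U ↔ ∃ h, (g, h) ∈ U := by
  simp [p₁, Subgroup.mem_map]

theorem mem_k₁ {U : Subgroup (G × H)} {g : G} : g ∈ k₁ U ↔ (g, 1) ∈ U := Iff.rfl

/-- `U` is a subdirect product of `G` and `H`: both coordinate projections of `U` are onto. -/
class IsSubdirect (U : Subgroup (G × H)) : Prop where
  p₁_eq_top : p₁ U = ⊤
  p₂_eq_top : p₂ U = ⊤

/-- Conjugation by an element of `p₁(U)` preserves `k₁(U)`. -/
theorem conj_mem_k₁ {U : Subgroup (G × H)} {n g : G} (hn : n ∈ k₁ U) (hg : g ∈ p₁ U) :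
    g * n * g⁻¹ ∈ k₁ U := by
  obtain ⟨h, hh⟩ := mem_p₁.1 hg
  have := U.mul_mem (U.mul_mem hh (mem_k₁.1 hn)) (U.inv_mem hh)
  rw [mem_k₁]
  simpa using this

instance normal_k₁_subgroupOf (U : Subgroup (G × H)) : ((k₁ U).subgroupOf (p₁ U)).Normal where
  conj_mem n hn g := conj_mem_k₁ (U := U) (n := n) (g := g) hn g.2

instance normal_k₁ (U : Subgroup (G × H)) [hU : IsSubdirect U] : (k₁ U).Normal where
  conj_mem _ hn g := conj_mem_k₁ hn (hU.p₁_eq_top ▸ Subgroup.mem_top g)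

/-- The Goursat quotient `q(U) = p₁(U) / k₁(U)`. -/
abbrev GoursatQuotient (U : Subgroup (G × H)) : Type u := p₁ U ⧸ (k₁ U).subgroupOf (p₁ U)

end Goursat

/-! ### Schur multiplier and coinflation -/

/-- The trivial `G`-module `ℤ` (lifted to the universe of `G`). -/
abbrev trivialInt (G : Type u) [Group G] : Rep.{u} (ULift.{u} ℤ) G :=
  Rep.trivial (ULift.{u} ℤ) G (ULift.{u} ℤ)

/-- The Schur multiplier `M(G) = H₂(G, ℤ)`. -/
abbrev SchurMultiplier (G : Type u) [Group G] : Type u := groupHomology.H2 (trivialInt G)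

/-- The coinflation map `H₂(G) → H₂(G / N)`: the map on integral homology induced by the
quotient homomorphism `G → G / N` and the identity of `ℤ`. -/
def coinflation {G : Type u} [Group G] (N : Subgroup G) [N.Normal] :
    SchurMultiplier G →+ SchurMultiplier (G ⧸ N) :=
  (groupHomology.map (A := trivialInt G) (B := trivialInt (G ⧸ N)) (QuotientGroup.mk' N)
    (Rep.ofHom ⟨LinearMap.id, fun _ => rfl⟩) 2).hom.toAddMonoidHom

/-- The `p`-primary component `M_p → N_p` of a homomorphism `f : M → N` of abelian groups:
the restriction of `f` to the `p`-primary parts. -/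
def primaryMap (p : ℕ) {M N : Type*} [AddCommGroup M] [AddCommGroup N] (f : M →+ N) :
    AddCommGroup.primaryComponent M p →+ AddCommGroup.primaryComponent N p :=
  (f.comp (AddCommGroup.primaryComponent M p).subtype).codRestrict
    (AddCommGroup.primaryComponent N p) fun x => by
      obtain ⟨k, hk⟩ := x.2
      exact ⟨k, by simpa using congrArg f hk⟩

/-! ### Extensibility -/

open Classical in
/-- The `π`-part `n_π` of a positive integer `n`. -/
def piPart (π : Set ℕ) (n : ℕ) : ℕ := ∏ q ∈ n.primeFactors with q ∈ π, q ^ n.factorization q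

/-- The hypothesis on the codomain `A`, for the set of primes `π`: for every positive integer `n`
the `n`-torsion part `{a ∈ A | a ^ n = 1}` is cyclic of order `n_π`. -/
structure TorsionHypothesis (A : Type w) [CommGroup A] (π : Set ℕ) : Prop where
  prime_of_mem : ∀ q ∈ π, q.Prime
  isCyclic : ∀ n : ℕ, 0 < n → IsCyclic (powMonoidHom n : A →* A).ker
  card_eq : ∀ n : ℕ, 0 < n → Nat.card (powMonoidHom n : A →* A).ker = piPart π n

/-- A group satisfies the hypothesis for at most one set of primes. -/
theorem TorsionHypothesis.unique {A : Type w} [CommGroup A] {π π' : Set ℕ}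
    (h : TorsionHypothesis A π) (h' : TorsionHypothesis A π') : π = π' := by
  have key : ∀ {σ τ : Set ℕ}, TorsionHypothesis A σ → TorsionHypothesis A τ → σ ⊆ τ := by
    intro σ τ hσ hτ q hq
    have hp := hσ.prime_of_mem q hq
    have e := (hσ.card_eq q hp.pos).symm.trans (hτ.card_eq q hp.pos)
    by_contra hq'
    simp only [piPart, hp.primeFactors, Finset.filter_singleton, if_pos hq, if_neg hq',
      Finset.prod_singleton, Finset.prod_empty, hp.factorization_self, pow_one] at e
    exact hp.one_lt.ne' e
  exact (key h h').antisymm (key h' h)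

variable {G : Type u} {H : Type v} [Group G] [Group H]

/-- `U ≤ G × H` is `A`-extensible: every homomorphism `U → A` extends to `G × H`. -/
def IsExtensibleTo (U : Subgroup (G × H)) (A : Type w) [CommGroup A] : Prop :=
  ∀ φ : U →* A, ∃ ψ : G × H →* A, ψ.comp U.subtype = φ

/-- `U ≤ G × H` is `p`-extensible: it is `A`-extensible for every abelian group `A` satisfying
the hypothesis for the set of primes `{p}`. -/
def IsPExtensible (p : ℕ) (U : Subgroup (G × H)) : Prop :=
  ∀ (A : Type w) [CommGroup A], TorsionHypothesis A {p} → IsExtensibleTo U A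

end SubdirectExt

end

/-! If the restriction `α` of `φ : U → A` to `k₁ U` extends to `G`, then dividing `φ` by that
extension leaves a map factoring through `H`, so `φ` extends (`exists_extension_of_k₁`). Since `U`
is finite, `φ` takes values in the torsion subgroup `T` of `A`, which is divisible by a count
(`TorsionHypothesis.exists_pow_eq`). Conjugation by `g ∈ G` lifts to `U`, so `α` is `G`-invariant.

The obstruction to extending `α` is a class in `H²(Q, T)` with `Q = G / k₁ U`. As `T` is divisible,
a class pairing to zero with `M(Q)` vanishes (`exists_eq_coboundary`). The obstruction becomes a
coboundary on `G`, so it kills the image of `M(G)`. Since `|Q|` kills `M(Q)` and `T` has no torsion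
prime to `p`, only the `p`-part of `M(Q)` matters, and either hypothesis places it in that image. -/

namespace SubdirectExt

/-! ### Pairing of functions with integral chains -/

section Pairing

variable {X Y : Type*} {T : Type w} [AddCommGroup T]

/-- The additive extension of a function `f : X → T` to finitely supported integral chains. -/
noncomputable def pairing (f : X → T) : (X →₀ ULift.{u} ℤ) →+ T :=
  Finsupp.liftAddHom fun x =>
    ((zmultiplesHom T) (f x)).comp (AddEquiv.ulift (α := ℤ)).toAddMonoidHom

@[simp]
theorem pairing_single (f : X → T) (x : X) (n : ULift.{u} ℤ) :
    pairing f (Finsupp.single x n) = n.down • f x := by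
  simp [pairing]
  rfl

theorem pairing_mapDomain (f : Y → T) (e : X → Y) (z : X →₀ ULift.{u} ℤ) :
    pairing f (z.mapDomain e) = pairing (f ∘ e) z := by
  induction z using Finsupp.induction_linear with
  | zero => simp
  | add a b ha hb => simp [Finsupp.mapDomain_add, ha, hb]
  | single x n => simp [Finsupp.mapDomain_single]

end Pairing

/-! ### Integral 2-cycles and 2-coboundaries -/

section Chains

open groupHomology Finsupp

variable {G : Type u} [Group G] {T : Type w} [AddCommGroup T]

theorem pairing_d₂₁ (f : G → T) (z : G × G →₀ ULift.{u} ℤ) :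
    pairing f (d₂₁ (trivialInt G) z : G →₀ ULift.{u} ℤ) =
      pairing (fun x : G × G => f x.2 - f (x.1 * x.2) + f x.1) z := by
  induction z using Finsupp.induction_linear with
  | zero => simp
  | add a b ha hb => rw [map_add, map_add, ha, hb, map_add]
  | single x n =>
    erw [d₂₁_single]
    simp [smul_add, smul_sub]

theorem pairing_d₃₂ (f : G × G → T)
    (hf : ∀ a b c, f (b, c) - f (a * b, c) + f (a, b * c) - f (a, b) = 0)
    (z : G × G × G →₀ ULift.{u} ℤ) :
    pairing f (d₃₂ (trivialInt G) z : G × G →₀ ULift.{u} ℤ) = 0 := by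
  induction z using Finsupp.induction_linear with
  | zero => simp
  | add a b ha hb => rw [map_add, map_add, ha, hb, add_zero]
  | single x n =>
    erw [d₃₂_single]
    simp [← smul_sub, ← smul_add, hf]

/-- Prepending each `g` to a chain and summing over `G` is a homotopy from multiplication by `|G|`
to zero. -/
theorem card_nsmul_mem_boundaries₂ [Finite G] (z : cycles₂ (trivialInt G)) :
    Nat.card G • (z : G × G →₀ ULift.{u} ℤ) ∈ boundaries₂ (trivialInt G) := by
  classical
  cases nonempty_fintype G
  let S : (G →₀ ULift.{u} ℤ) →+ (G × G →₀ ULift.{u} ℤ) :=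
    ∑ g : G, (mapDomain.addMonoidHom fun a => (g, a))
  let P : (G × G →₀ ULift.{u} ℤ) →+ (G × G × G →₀ ULift.{u} ℤ) :=
    ∑ g : G, (mapDomain.addMonoidHom fun a => (g, a))
  -- Homotopy identity `d P + S d = |G|`; on cycles the term `S d` disappears.
  have key (z : G × G →₀ ULift.{u} ℤ) :
      (d₃₂ (trivialInt G) (P z) : G × G →₀ ULift.{u} ℤ) =
        Nat.card G • z - S (d₂₁ (trivialInt G) z : G →₀ ULift.{u} ℤ) := by
    induction z using Finsupp.induction_linear with
    | zero => simp
    | add a b ha hb =>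
      rw [map_add, map_add, ha, hb, map_add, map_add, smul_add]
      abel
    | single x n =>
      have h1 : P (single x n) = ∑ g : G, single (g, x) n := by
        simp [P, mapDomain_single]
      have h2 (a : G) : S (single a n) = ∑ g : G, single (g, a) n := by
        simp [S, mapDomain_single]
      have h3 : (∑ g : G, single (g * x.1, x.2) n : G × G →₀ ULift.{u} ℤ) =
          ∑ g : G, single (g, x.2) n :=
        Equiv.sum_comp (Equiv.mulRight x.1) fun g => (single (g, x.2) n : G × G →₀ ULift.{u} ℤ)
      have h4 : (d₂₁ (trivialInt G) (single x n) : G →₀ ULift.{u} ℤ) =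
          single x.2 n - single (x.1 * x.2) n + single x.1 n := d₂₁_single (A := trivialInt G) _ _
      have h5 (g : G) : (d₃₂ (trivialInt G) (single (g, x) n) : G × G →₀ ULift.{u} ℤ) =
          single x n - single (g * x.1, x.2) n + single (g, x.1 * x.2) n -
            single (g, x.1) n := d₃₂_single (A := trivialInt G) _ _
      rw [h1, map_sum, h4, map_add, map_sub, h2, h2, h2]
      refine (Finset.sum_congr rfl fun g _ => h5 g).trans ?_
      rw [Finset.sum_sub_distrib, Finset.sum_add_distrib, Finset.sum_sub_distrib, h3,
        Finset.sum_const, Finset.card_univ, Nat.card_eq_fintype_card]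
      abel
  refine ⟨P z, (key z).trans ?_⟩
  have hz : (d₂₁ (trivialInt G) (z : G × G →₀ ULift.{u} ℤ) : G →₀ ULift.{u} ℤ) = 0 := z.2
  rw [hz, map_zero, sub_zero]

theorem card_nsmul_schurMultiplier [Finite G] (x : SchurMultiplier G) : Nat.card G • x = 0 := by
  induction x using H2_induction_on with
  | h z =>
    rw [← map_nsmul, H2π_eq_zero_iff]
    exact card_nsmul_mem_boundaries₂ z

/-- A function on `G × G` pairing trivially with all integral 2-cycles is a 2-coboundary, when its
values lie in a divisible group. -/
theorem exists_eq_coboundary [DivisibleBy T ℤ] (f : G × G → T)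
    (hf : ∀ z : cycles₂ (trivialInt G), pairing f (z : G × G →₀ ULift.{u} ℤ) = 0) :
    ∃ γ : G → T, ∀ a b, f (a, b) = γ b - γ (a * b) + γ a := by
  let D : (G × G →₀ ULift.{u} ℤ) →+ (G →₀ ULift.{u} ℤ) := (d₂₁ (trivialInt G)).hom.toAddMonoidHom
  -- The pairing kills cycles, so it descends to boundaries; injectivity of `T` then extends it to
  -- all 1-chains, and its values on basis elements give `γ`.
  let F : D.range →+ T :=
    (QuotientAddGroup.lift D.ker (pairing f) fun z hz => hf ⟨z, hz⟩).comp
      (QuotientAddGroup.quotientKerEquivRange D).symm.toAddMonoidHom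
  obtain ⟨E, hE⟩ := (Module.Baer.of_divisible T).extension_property_addMonoidHom D.range.subtype
    Subtype.val_injective F
  have hED (z) : E (D z) = pairing f z := by
    have h1 : (QuotientAddGroup.quotientKerEquivRange D).symm (D.rangeRestrict z) = (z : _ ⧸ D.ker) := by
      rw [AddEquiv.symm_apply_eq]; rfl
    have h2 := DFunLike.congr_fun hE (D.rangeRestrict z)
    simp only [F, AddMonoidHom.comp_apply, AddEquiv.coe_toAddMonoidHom, h1] at h2
    exact h2
  refine ⟨fun a => E (single a ⟨1⟩), fun a b => ?_⟩
  have h1 : D (single (a, b) ⟨1⟩) = single b ⟨1⟩ - single (a * b) ⟨1⟩ + single a ⟨1⟩ :=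
    d₂₁_single (A := trivialInt G) _ _
  have h2 := hED (single (a, b) ⟨1⟩)
  rw [h1] at h2
  simpa using h2.symm

end Chains

/-! ### Extending an invariant homomorphism from a kernel -/

section Extension

open groupHomology

variable {G Q : Type u} [Group G] [Group Q] {T : Type w} [AddCommGroup T]

/-- The homomorphism of Schur multipliers induced by a group homomorphism. -/
noncomputable def schurMap (π : G →* Q) : SchurMultiplier G →+ SchurMultiplier Q :=
  (groupHomology.map (A := trivialInt G) (B := trivialInt Q) π
    (Rep.ofHom ⟨LinearMap.id, fun _ => rfl⟩) 2).hom.toAddMonoidHom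

theorem schurMap_H2π (π : G →* Q) (y : cycles₂ (trivialInt G)) :
    ∃ y' : cycles₂ (trivialInt Q),
      (y' : Q × Q →₀ ULift.{u} ℤ) =
        (y : G × G →₀ ULift.{u} ℤ).mapDomain (Prod.map π π) ∧
      schurMap π (H2π _ y) = H2π _ y' := by
  refine ⟨mapCycles₂ (A := trivialInt G) (B := trivialInt Q) π
    (Rep.ofHom ⟨LinearMap.id, fun _ => rfl⟩) y, ?_, ?_⟩
  · rw [coe_mapCycles₂]
    simp [chainsMap₂]
  · exact H2π_comp_map_apply (A := trivialInt G) (B := trivialInt Q) π _ y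

/-- A `2`-cocycle on `Q` that becomes a coboundary on `G` is a coboundary, if every class in `M(Q)`
has a multiple prime to the torsion of `T` that comes from `M(G)`. -/
theorem exists_eq_coboundary_of_inflation [DivisibleBy T ℤ] (π : G →* Q)
    (hM : ∀ x : SchurMultiplier Q, ∃ m : ℕ, (∀ t : T, m • t = 0 → t = 0) ∧
      ∃ y : SchurMultiplier G, m • x = schurMap π y)
    (f : Q × Q → T) (hf : ∀ a b c, f (b, c) - f (a * b, c) + f (a, b * c) - f (a, b) = 0)
    (c : G → T) (hc : ∀ g h, f (π g, π h) = c h - c (g * h) + c g) :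
    ∃ γ : Q → T, ∀ a b, f (a, b) = γ b - γ (a * b) + γ a := by
  refine exists_eq_coboundary f fun z => ?_
  obtain ⟨m, hm, y, hy⟩ := hM (H2π _ z)
  apply hm
  induction y using H2_induction_on with
  | h y =>
    obtain ⟨y', h1, h2⟩ := schurMap_H2π π y
    rw [h2, ← map_nsmul, H2π_eq_iff] at hy
    obtain ⟨w, hw⟩ := hy
    have h3 := pairing_d₃₂ f hf w
    have h4 : (d₃₂ (trivialInt Q) w : Q × Q →₀ ULift.{u} ℤ) =
        m • (z : Q × Q →₀ ULift.{u} ℤ) - y' := hw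
    have h5 : f ∘ Prod.map π π = fun x : G × G => c x.2 - c (x.1 * x.2) + c x.1 :=
      funext fun x => hc x.1 x.2
    have h6 : (d₂₁ (trivialInt G) (y : G × G →₀ ULift.{u} ℤ) : G →₀ ULift.{u} ℤ) = 0 := y.2
    rw [h4, map_sub, map_nsmul, h1, pairing_mapDomain, h5, ← pairing_d₂₁, h6, map_zero,
      sub_zero] at h3
    exact h3

/-- An invariant homomorphism from the kernel of a surjection `π : G → Q` to a divisible group `T`
extends to `G`, if every class in `M(Q)` has a multiple prime to the torsion of `T` that comes
from `M(G)`. -/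
theorem exists_extension [DivisibleBy T ℤ] (π : G →* Q) (hπ : Function.Surjective π)
    (hM : ∀ x : SchurMultiplier Q, ∃ m : ℕ, (∀ t : T, m • t = 0 → t = 0) ∧
      ∃ y : SchurMultiplier G, m • x = schurMap π y)
    (α : π.ker →* Multiplicative T)
    (hα : ∀ (g : G) (x y : π.ker), (y : G) = g * x * g⁻¹ → α y = α x) :
    ∃ β : G →* Multiplicative T, ∀ x : π.ker, β x = α x := by
  obtain ⟨s, hs⟩ := hπ.hasRightInverse
  let a (g : G) (hg : π g = 1) : T := (α ⟨g, hg⟩).toAdd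
  have amul (g h k : G) (hg : π g = 1) (hh : π h = 1) (hk : π k = 1) (e : k = g * h) :
      a k hk = a g hg + a h hh := by
    subst e
    exact congrArg Multiplicative.toAdd (map_mul α ⟨g, hg⟩ ⟨h, hh⟩)
  have aconj (g x y : G) (hx : π x = 1) (hy : π y = 1) (e : y = g * x * g⁻¹) :
      a y hy = a x hx :=
    congrArg Multiplicative.toAdd (hα g ⟨x, hx⟩ ⟨y, hy⟩ e)
  -- The factor set of the section `s`, pushed forward along `α`; `c` trivializes its inflation to
  -- `G`, up to sign.
  let f (x : Q × Q) : T := a (s x.1 * s x.2 * (s (x.1 * x.2))⁻¹) (by simp [hs _])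
  let c (g : G) : T := a (g * (s (π g))⁻¹) (by simp [hs _])
  -- Both sides come from reducing `s x * s y * s z` to `s (x * y * z)` in the two possible orders.
  have hf (x y z : Q) : f (y, z) - f (x * y, z) + f (x, y * z) - f (x, y) = 0 := by
    have e1 : a (s x * (s y * s z * (s (y * z))⁻¹) * (s x)⁻¹) (by simp [hs _]) = f (y, z) :=
      aconj (s x) _ _ _ _ rfl
    have e2 : a (s x * s y * s z * (s (x * y * z))⁻¹) (by simp [hs _]) =
        f (x, y) + f (x * y, z) :=
      amul _ _ _ _ _ _ (by group)
    have e3 : a (s x * s y * s z * (s (x * y * z))⁻¹) (by simp [hs _]) =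
        a (s x * (s y * s z * (s (y * z))⁻¹) * (s x)⁻¹) (by simp [hs _]) + f (x, y * z) :=
      amul _ _ _ _ _ _ (by simp [mul_assoc])
    rw [e2, e1] at e3
    rw [sub_add_eq_add_sub, ← e3]
    abel
  have hc (g h : G) : f (π g, π h) = (-c h) - (-c (g * h)) + (-c g) := by
    have e0 : a (s (π g) * (h * (s (π h))⁻¹) * (s (π g))⁻¹) (by simp [hs _]) = c h :=
      aconj (s (π g)) _ _ _ _ rfl
    have e1 : a (s (π g) * h * (s (π h))⁻¹ * (s (π g))⁻¹) (by simp [hs _]) = c h := by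
      rw [← e0]
      simp only [mul_assoc]
    have e2 : a (g * h * (s (π h))⁻¹ * (s (π g))⁻¹) (by simp [hs _]) = c g + c h := by
      rw [← e1]
      exact amul _ _ _ _ _ _ (by group)
    have e3 : c (g * h) = a (g * h * (s (π h))⁻¹ * (s (π g))⁻¹) (by simp [hs _]) +
        f (π g, π h) :=
      amul _ _ _ _ _ _ (by simp [mul_assoc])
    rw [e3, e2]
    abel
  obtain ⟨γ, hγ⟩ := exists_eq_coboundary_of_inflation π hM f hf _ hc
  have hsum (g h : G) : c (g * h) + γ (π (g * h)) = (c g + γ (π g)) + (c h + γ (π h)) := by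
    have e1 := hc g h
    rw [hγ, ← sub_eq_zero] at e1
    rw [← sub_eq_zero, ← neg_eq_zero, ← e1, map_mul]
    abel
  refine ⟨MonoidHom.mk' (fun g => Multiplicative.ofAdd (c g + γ (π g)))
    fun g h => congrArg Multiplicative.ofAdd (hsum g h), fun x => ?_⟩
  have hx : π x = 1 := x.2
  -- The section need not satisfy `s 1 = 1`, so `c 1` may be nonzero; it cancels against `γ 1`.
  have h1 : c x = a x hx + c 1 := by
    refine amul _ _ _ _ _ _ ?_
    simp [hx]
  have h2 : c 1 + γ (π 1) = 0 := by simpa using hsum 1 1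
  have h3 : c x + γ (π x) = a x hx := by
    rw [h1, hx, add_assoc, ← map_one π, h2, add_zero]
  exact congrArg Multiplicative.ofAdd h3

end Extension

/-! ### Divisibility of the torsion subgroup -/

section Torsion

variable {A : Type w} [CommGroup A] {p : ℕ}

theorem piPart_singleton (hp : p.Prime) {n : ℕ} (hn : 0 < n) :
    piPart {p} n = p ^ n.factorization p := by
  rw [piPart, Finset.prod_filter, Finset.prod_eq_single p]
  · exact if_pos rfl
  · exact fun q _ hq => if_neg hq
  · intro h
    have : ¬ p ∣ n := fun hpn => h (Nat.mem_primeFactors.2 ⟨hp, hpn, hn.ne'⟩)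
    simp [Nat.factorization_eq_zero_of_not_dvd this]

variable (hA : TorsionHypothesis A {p})
include hA

theorem TorsionHypothesis.prime : p.Prime := hA.prime_of_mem p rfl

theorem TorsionHypothesis.card_torsion {n : ℕ} (hn : 0 < n) :
    Nat.card (powMonoidHom n : A →* A).ker = p ^ n.factorization p := by
  rw [hA.card_eq n hn, piPart_singleton hA.prime hn]

theorem TorsionHypothesis.eq_one_of_pow_eq_one {n : ℕ} (hn : 0 < n) (h : ¬ p ∣ n) {a : A}
    (ha : a ^ n = 1) : a = 1 := by
  have h1 := hA.card_torsion hn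
  rw [Nat.factorization_eq_zero_of_not_dvd h, pow_zero, Subgroup.card_eq_one] at h1
  have : a ∈ (powMonoidHom n : A →* A).ker := ha
  rwa [h1, Subgroup.mem_bot] at this

/-- The `n`-th power sends the `nm`-torsion into the `m`-torsion with kernel inside the `n`-torsion.
The `p`-part is multiplicative, so the orders force the image to be everything. -/
theorem TorsionHypothesis.exists_pow_eq {m n : ℕ} (hm : 0 < m) (hn : 0 < n) {a : A}
    (ha : a ^ m = 1) : ∃ b : A, b ^ (n * m) = 1 ∧ b ^ n = a := by
  have hfin {k : ℕ} (hk : 0 < k) : Finite (powMonoidHom k : A →* A).ker :=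
    Nat.finite_of_card_ne_zero (by rw [hA.card_torsion hk]; exact pow_ne_zero _ hA.prime.ne_zero)
  have := hfin hm
  have := hfin hn
  let F : (powMonoidHom (n * m) : A →* A).ker →* A :=
    (powMonoidHom n).comp (Subgroup.subtype _)
  have hle : F.range ≤ (powMonoidHom m : A →* A).ker := by
    rintro _ ⟨x, rfl⟩
    have hx : (x : A) ^ (n * m) = 1 := x.2
    rw [pow_mul] at hx
    exact hx
  have hker : Nat.card F.ker ≤ Nat.card (powMonoidHom n : A →* A).ker :=
    Nat.card_le_card_of_injective (fun x => ⟨x.1.1, x.2⟩) fun x y h =>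
      Subtype.ext (Subtype.ext (congrArg (fun z => z.1) h))
  have hcard : Nat.card F.ker * Nat.card F.range =
      Nat.card (powMonoidHom (n * m) : A →* A).ker := by
    rw [← Subgroup.index_ker, Subgroup.card_mul_index]
  have heq : F.range = (powMonoidHom m : A →* A).ker := by
    refine Subgroup.eq_of_le_of_card_ge hle ?_
    rw [hA.card_torsion (Nat.mul_pos hn hm), Nat.factorization_mul hn.ne' hm.ne',
      Finsupp.add_apply, pow_add, ← hA.card_torsion hn, ← hA.card_torsion hm] at hcard
    have : 0 < Nat.card (powMonoidHom n : A →* A).ker := Nat.card_pos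
    refine Nat.le_of_mul_le_mul_left ?_ this
    rw [← hcard]
    exact Nat.mul_le_mul_right _ hker
  have ha' : a ∈ F.range := heq ▸ ha
  obtain ⟨x, hx⟩ := ha'
  exact ⟨x, x.2, hx⟩

theorem TorsionHypothesis.nsmul_surjective {n : ℕ} (hn : n ≠ 0) :
    Function.Surjective fun t : Additive (CommGroup.torsion A) => n • t := by
  intro t
  obtain ⟨m, hm, h⟩ := isOfFinOrder_iff_pow_eq_one.1 t.toMul.2
  obtain ⟨b, hb, hbt⟩ := hA.exists_pow_eq hm (Nat.pos_of_ne_zero hn) h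
  refine ⟨Additive.ofMul ⟨b, isOfFinOrder_iff_pow_eq_one.2
    ⟨n * m, Nat.mul_pos (Nat.pos_of_ne_zero hn) hm, hb⟩⟩, ?_⟩
  exact congrArg Additive.ofMul (Subtype.ext hbt)

theorem TorsionHypothesis.eq_zero_of_nsmul_eq_zero {n : ℕ} (hn : 0 < n) (h : ¬ p ∣ n)
    (t : Additive (CommGroup.torsion A)) (ht : n • t = 0) : t = 0 := by
  have h1 : (t.toMul : A) ^ n = 1 := congrArg (fun x : Additive (CommGroup.torsion A) => (x.toMul : A)) ht
  exact congrArg Additive.ofMul (Subtype.ext (hA.eq_one_of_pow_eq_one hn h h1))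

end Torsion

/-! ### From the Schur multiplier to extensibility -/

section Extensible

variable {G : Type u} {H : Type v} [Group G] [Group H]

/-- A homomorphism from a subdirect product `U` to an abelian group extends to `G × H` as soon as
its restriction to `k₁ U` extends to `G`. -/
theorem exists_extension_of_k₁ {A : Type w} [CommGroup A] (U : Subgroup (G × H))
    [hU : IsSubdirect U] (φ : U →* A) (β : G →* A)
    (hβ : ∀ (g : G) (hg : (g, 1) ∈ U), β g = φ ⟨(g, 1), hg⟩) :
    ∃ ψ : G × H →* A, ψ.comp U.subtype = φ := by
  let δ : U →* A := φ / β.comp ((MonoidHom.fst G H).comp U.subtype)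
  let q : U →* H := (MonoidHom.snd G H).comp U.subtype
  have hq : Function.Surjective q := fun h => by
    have : h ∈ p₂ U := hU.p₂_eq_top ▸ Subgroup.mem_top h
    obtain ⟨x, hx, rfl⟩ := this
    exact ⟨⟨x, hx⟩, rfl⟩
  have hδ : q.ker ≤ δ.ker := by
    rintro ⟨⟨g, h⟩, hx⟩ (rfl : h = 1)
    simp [δ, MonoidHom.mem_ker, hβ g hx]
  refine ⟨β.coprod (q.liftOfSurjective hq ⟨δ, hδ⟩), MonoidHom.ext fun x => ?_⟩
  have h1 : q.liftOfSurjective hq ⟨δ, hδ⟩ (q x) = δ x :=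
    q.liftOfRightInverse_comp_apply _ _ ⟨δ, hδ⟩ x
  change β x.1.1 * q.liftOfSurjective hq ⟨δ, hδ⟩ (q x) = φ x
  rw [h1]
  simp [δ]

/-- `U` is `p`-extensible if the `p`-primary part of the Schur multiplier of a quotient `Q` of `G`
by `k₁ U` consists of images of elements of `M(G)`. -/
theorem isPExtensible_of_schurMap [Finite G] [Finite H] {Q : Type u} [Group Q] {p : ℕ}
    (hp : p.Prime) (U : Subgroup (G × H)) [hU : IsSubdirect U] (π : G →* Q)
    (hπ : Function.Surjective π) (hker : π.ker = k₁ U)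
    (hM : ∀ x ∈ AddCommGroup.primaryComponent (SchurMultiplier Q) p, ∃ y, x = schurMap π y) :
    IsPExtensible.{u, v, w} p U := by
  intro A _ hA φ
  have : Finite Q := Finite.of_surjective π hπ
  let _ : DivisibleBy (Additive (CommGroup.torsion A)) ℕ :=
    divisibleByOfSMulRightSurj _ _ fun hn => hA.nsmul_surjective hn
  let _ : DivisibleBy (Additive (CommGroup.torsion A)) ℤ :=
    AddGroup.divisibleByIntOfDivisibleByNat _
  let φ' : U →* CommGroup.torsion A :=
    φ.codRestrict _ fun x => φ.isOfFinOrder (isOfFinOrder_of_finite x)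
  let ι : π.ker →* U :=
    { toFun := fun x => ⟨(x, 1), (hker ▸ x.2 : (x : G) ∈ k₁ U)⟩
      map_one' := rfl
      map_mul' := fun x y => Subtype.ext (Prod.ext rfl (mul_one 1).symm) }
  let e := MulEquiv.multiplicativeAdditive (CommGroup.torsion A)
  have hM' (x : SchurMultiplier Q) :
      ∃ m : ℕ, (∀ t : Additive (CommGroup.torsion A), m • t = 0 → t = 0) ∧
        ∃ y : SchurMultiplier G, m • x = schurMap π y := by
    have hQ : Nat.card Q ≠ 0 := Nat.card_pos.ne'
    -- The prime-to-`p` part of `|Q|` acts injectively on `T` and moves `M(Q)` into its `p`-primary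
    -- part.
    refine ⟨Nat.card Q / p ^ (Nat.card Q).factorization p,
      hA.eq_zero_of_nsmul_eq_zero (Nat.ordCompl_pos p hQ) (Nat.not_dvd_ordCompl hp hQ),
      hM _ ⟨(Nat.card Q).factorization p, ?_⟩⟩
    rw [← mul_smul, Nat.ordProj_mul_ordCompl_eq_self]
    exact card_nsmul_schurMultiplier x
  have hinv (g : G) (x y : π.ker) (hxy : (y : G) = g * x * g⁻¹) : φ' (ι y) = φ' (ι x) := by
    have hg : g ∈ p₁ U := hU.p₁_eq_top ▸ Subgroup.mem_top g
    obtain ⟨h, hgh⟩ := mem_p₁.1 hg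
    have : ι y = ⟨(g, h), hgh⟩ * ι x * ⟨(g, h), hgh⟩⁻¹ :=
      Subtype.ext (Prod.ext hxy (by simp [ι]))
    rw [this, map_mul, map_mul, map_inv, mul_right_comm, mul_inv_cancel, one_mul]
  obtain ⟨β, hβ⟩ := exists_extension π hπ hM' (e.symm.toMonoidHom.comp (φ'.comp ι))
    fun g x y hxy => congrArg e.symm (hinv g x y hxy)
  refine exists_extension_of_k₁ U φ
    ((CommGroup.torsion A).subtype.comp (e.toMonoidHom.comp β)) fun g hg => ?_
  have hg' : g ∈ π.ker := hker ▸ hg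
  exact congrArg (fun t => ((e t : CommGroup.torsion A) : A)) (hβ ⟨g, hg'⟩)

end Extensible

end SubdirectExt

open SubdirectExt in
theorem mainTheorem1 {G : Type u} {H : Type v} [Group G] [Group H] [Finite G] [Finite H]
    (p : ℕ) (hp : p.Prime) (U : Subgroup (G × H)) [hU : SubdirectExt.IsSubdirect U]
    (h : AddCommGroup.primaryComponent
          (SubdirectExt.SchurMultiplier (SubdirectExt.GoursatQuotient U)) p = ⊥ ∨
        Function.Surjective
          (SubdirectExt.primaryMap p (SubdirectExt.coinflation (SubdirectExt.k₁ U)))) :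
    SubdirectExt.IsPExtensible.{u, v, w} p U := by
  rcases h with h | h
  -- The Goursat quotient is formed from `p₁ U`, so `G` is first mapped onto this full subgroup.
  · let e : G →* p₁ U := (MonoidHom.id G).codRestrict (p₁ U) fun g => hU.p₁_eq_top ▸ Subgroup.mem_top g
    refine isPExtensible_of_schurMap hp U ((QuotientGroup.mk' ((k₁ U).subgroupOf (p₁ U))).comp e)
      ((QuotientGroup.mk'_surjective _).comp fun x => ⟨x, rfl⟩) ?_ fun x hx => ⟨0, ?_⟩
    · ext g
      exact QuotientGroup.eq_one_iff (e g)
    · rw [h] at hx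
      rw [map_zero]
      exact hx
  · refine isPExtensible_of_schurMap hp U (QuotientGroup.mk' (k₁ U))
      (QuotientGroup.mk'_surjective _) (QuotientGroup.ker_mk' _) fun x hx => ?_
    obtain ⟨y, hy⟩ := h ⟨x, hx⟩
    exact ⟨y, (congrArg Subtype.val hy).symm⟩
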